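/- Let $\mathcal A,\mathcal B,\mathcal X,\mathcal Y$ be finite sets. A correlation is a family $(p_{ab}^{xy})$ of nonnegative reals with $\sum_{x,y}p_{ab}^{xy}=1$ for all $a\in\mathcal A$, $b\in\mathcal B$, such that $\sum_y p_{ab}^{xy}$ is independent of $b$ and $\sum_x p_{ab}^{xy}$ is independent of $a$; it is classical if it is a convex combination of product correlations $q_a^x r_b^y$, where $q_a$ and $r_b$ are probability distributions on $\mathcal X$ and $\mathcal Y$ for all $a,b$. A game is a pair $(q,H)$ of a probability distribution $q$ on $\mathcal A\times\mathcal B$ and a function $H:\mathcal A\times\mathcal B\times\mathcal X\times\mathcal Y\to[0,\infty)$; it has complete support if $q(a,b)\neq 0$ for all $a,b$. The expected score of $(p_{ab}^{xy})$ is $\sum_{a,b,x,y}q(a,b)H(a,b,x,y)p_{ab}^{xy}$, and the correlation is super-classical for the game if its expected score is greater than that of every classical correlation. A strategy $\Gamma$ consists of finite-dimensional Hilbert spaces $D$ (Alice) and $E$ (Bob), a positive operator valued measure $\{R_a^x\}_{x\in\mathcal X}$ on $D$ for each $a\in\mathcal A$, a positive operator valued measure $\{S_b^y\}_{y\in\mathcal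 Y}$ on $E$ for each $b\in\mathcal B$, and a density operator $\gamma$ on $D\otimes E$. It achieves the correlation $p_{ab}^{xy}=\mathrm{Tr}[\gamma(R_a^x\otimes S_b^y)]$. It allows perfect guessing by Bob if, for all $a,b,y$, the operators $$\rho_{ab}^{xy}=\mathrm{Tr}_D\left[\sqrt{R_a^x\otimes S_b^y}\;\gamma\,\sqrt{R_a^x\otimes S_b^y}\right],\qquad x\in\mathcal X,$$ have pairwise orthogonal supports. Corollary. Let $(q,H)$ be a game with complete support and $\Gamma$ a strategy for it. If $\Gamma$ allows perfect guessing by Bob, then the correlation achieved by $\Gamma$ is classical. Consequently, if the correlation achieved by $\Gamma$ is super-classical for the game, then $\Gamma$ does not allow perfect guessing by Bob. -/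

import Mathlib

/-!
Two-player games, two-player input-output correlations, and finite-dimensional quantum strategies.
Alice has input alphabet `A` and output alphabet `X`, Bob has input alphabet `B` and output
alphabet `Y`.  A finite-dimensional Hilbert space is given with an orthonormal basis, indexed by a
finite type; its operators are the complex square matrices over that type, and the tensor product
of two such spaces has the product of the two index types as the index type of its basis.
-/

/-- A two-player (input-output) correlation `p a b x y`. -/
structure Correlation (A B X Y : Type*) [Fintype X] [Fintype Y] where
  /-- The probability of the outputs `x, y` on the inputs `a, b`. -/
  p : A → B → X → Y → ℝ
  nonneg : ∀ a b x y, 0 ≤ p a b x y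
  sum_eq_one : ∀ a b, ∑ x, ∑ y, p a b x y = 1
  /-- Alice's marginal does not depend on Bob's input. -/
  marginal_left : ∀ a b b' x, ∑ y, p a b x y = ∑ y, p a b' x y
  /-- Bob's marginal does not depend on Alice's input. -/
  marginal_right : ∀ a a' b y, ∑ x, p a b x y = ∑ x, p a' b x y

/-- The product distributions `q a x * r b y`, where `q a` and `r b` are probability
distributions for all inputs `a` and `b`. -/
def productCorrelations (A B X Y : Type*) [Fintype X] [Fintype Y] :
    Set (A → B → X → Y → ℝ) :=
  {p | ∃ (q : A → X → ℝ) (r : B → Y → ℝ),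
    (∀ a x, 0 ≤ q a x) ∧ (∀ a, ∑ x, q a x = 1) ∧
    (∀ b y, 0 ≤ r b y) ∧ (∀ b, ∑ y, r b y = 1) ∧
    ∀ a b x y, p a b x y = q a x * r b y}

/-- A correlation is classical if it is a convex combination of product distributions. -/
def Correlation.IsClassical {A B X Y : Type*} [Fintype X] [Fintype Y]
    (P : Correlation A B X Y) : Prop :=
  P.p ∈ convexHull ℝ (productCorrelations A B X Y)

/-- A two-player game: a probability distribution `q` on the input pairs and a nonnegative scoring
function `H`. -/
structure Game (A B X Y : Type*) [Fintype A] [Fintype B] where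
  /-- The probability of the input pair `a, b`. -/
  q : A → B → ℝ
  /-- The score of the inputs `a, b` and the outputs `x, y`. -/
  H : A → B → X → Y → ℝ
  q_nonneg : ∀ a b, 0 ≤ q a b
  q_sum : ∑ a, ∑ b, q a b = 1
  H_nonneg : ∀ a b x y, 0 ≤ H a b x y

/-- Every input pair has a nonzero probability. -/
def Game.HasCompleteSupport {A B X Y : Type*} [Fintype A] [Fintype B]
    (G : Game A B X Y) : Prop :=
  ∀ a b, G.q a b ≠ 0

/-- The expected score of a correlation at a game. -/
def Game.score {A B X Y : Type*} [Fintype A] [Fintype B] [Fintype X] [Fintype Y]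
    (G : Game A B X Y) (P : Correlation A B X Y) : ℝ :=
  ∑ a, ∑ b, ∑ x, ∑ y, G.q a b * G.H a b x y * P.p a b x y

/-- A correlation is superclassical at a game (it violates the Bell inequality of the game) if its
expected score is higher than that of every classical correlation. -/
def Game.IsSuperclassical {A B X Y : Type*} [Fintype A] [Fintype B] [Fintype X] [Fintype Y]
    (G : Game A B X Y) (P : Correlation A B X Y) : Prop :=
  ∀ C : Correlation A B X Y, C.IsClassical → G.score C < G.score P

open scoped ComplexOrder in
/-- An `X`-valued positive operator valued measure on the Hilbert space with basis `D`. -/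
structure POVM (X D : Type*) [Fintype X] [Fintype D] [DecidableEq D] where
  /-- The measurement operators. -/
  op : X → Matrix D D ℂ
  posSemidef : ∀ x, (op x).PosSemidef
  sum_eq_one : ∑ x, op x = 1

open scoped ComplexOrder in
/-- A two-player quantum strategy on the finite-dimensional Hilbert spaces with bases `D` (Alice)
and `E` (Bob). -/
structure Strategy (A B X Y D E : Type*) [Fintype X] [Fintype Y]
    [Fintype D] [DecidableEq D] [Fintype E] [DecidableEq E] where
  /-- Alice's measurements. -/
  R : A → POVM X D
  /-- Bob's measurements. -/
  S : B → POVM Y E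
  /-- The shared state, a density operator. -/
  γ : Matrix (D × E) (D × E) ℂ
  γ_posSemidef : γ.PosSemidef
  γ_trace : γ.trace = 1

/-- The partial trace over the first tensor factor. -/
def partialTraceLeft {D E : Type*} [Fintype D] (M : Matrix (D × E) (D × E) ℂ) : Matrix E E ℂ :=
  Matrix.of fun e e' => ∑ d, M (d, e) (d, e')

/-- The support of a positive semidefinite operator: the orthogonal complement of its kernel. -/
noncomputable def opSupport {E : Type*} [Fintype E] [DecidableEq E] (M : Matrix E E ℂ) :
    Submodule ℂ (EuclideanSpace ℂ E) :=
  (LinearMap.ker (Matrix.toEuclideanLin M))ᗮ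

/-- A family of positive semidefinite operators is perfectly distinguishable if any two of them,
at different indices, have orthogonal supports. -/
def PerfectlyDistinguishable {X E : Type*} [Fintype E] [DecidableEq E]
    (χ : X → Matrix E E ℂ) : Prop :=
  ∀ x x', x ≠ x' → (opSupport (χ x)).IsOrtho (opSupport (χ x'))

namespace Strategy

open scoped Kronecker MatrixOrder ComplexOrder

variable {A B X Y D E : Type*} [Fintype X] [Fintype Y]
  [Fintype D] [DecidableEq D] [Fintype E] [DecidableEq E]

/-- The (subnormalized) state of the second player after both measurements, on the inputs `a, b`
and the outputs `x, y`. -/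
noncomputable def secondPlayerState (Γ : Strategy A B X Y D E) (a : A) (b : B) (x : X) (y : Y) :
    Matrix E E ℂ :=
  partialTraceLeft
    (CFC.sqrt ((Γ.R a).op x ⊗ₖ (Γ.S b).op y) * Γ.γ * CFC.sqrt ((Γ.R a).op x ⊗ₖ (Γ.S b).op y))

/-- The strategy allows perfect guessing by Bob: given both inputs and his own output, the
states in his possession for the different outputs of Alice are perfectly distinguishable. -/
def AllowsPerfectGuessing (Γ : Strategy A B X Y D E) : Prop :=
  ∀ a b y, PerfectlyDistinguishable fun x => Γ.secondPlayerState a b x y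

/-- The strategy achieves the correlation `P`. -/
def Achieves (Γ : Strategy A B X Y D E) (P : Correlation A B X Y) : Prop :=
  ∀ a b x y, (P.p a b x y : ℂ) = (Γ.γ * ((Γ.R a).op x ⊗ₖ (Γ.S b).op y)).trace

/-- Every strategy achieves exactly one correlation. -/
theorem existsUnique_achieves (Γ : Strategy A B X Y D E) :
    ∃! P : Correlation A B X Y, Γ.Achieves P := by
  have hpos : ∀ a b x y, 0 ≤ (Γ.γ * ((Γ.R a).op x ⊗ₖ (Γ.S b).op y)).trace := by
    intro a b x y
    have h := ((Γ.R a).posSemidef x).kronecker ((Γ.S b).posSemidef y)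
    have hs := (Matrix.nonneg_iff_posSemidef.mp (CFC.sqrt_nonneg
      ((Γ.R a).op x ⊗ₖ (Γ.S b).op y))).isHermitian
    rw [← CFC.sqrt_mul_sqrt_self _ (Matrix.nonneg_iff_posSemidef.mpr h), ← mul_assoc,
      Matrix.trace_mul_comm, ← mul_assoc]
    nth_rewrite 2 [← hs.eq]
    exact (Γ.γ_posSemidef.mul_mul_conjTranspose_same _).trace_nonneg
  have hre : ∀ a b x y, ((Γ.γ * ((Γ.R a).op x ⊗ₖ (Γ.S b).op y)).trace.re : ℂ)
      = (Γ.γ * ((Γ.R a).op x ⊗ₖ (Γ.S b).op y)).trace :=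
    fun a b x y => (Complex.eq_re_of_ofReal_le (hpos a b x y)).symm
  have hy : ∀ a b x, ∑ y, (Γ.γ * ((Γ.R a).op x ⊗ₖ (Γ.S b).op y)).trace
      = (Γ.γ * ((Γ.R a).op x ⊗ₖ 1)).trace := by
    intro a b x
    rw [← Matrix.trace_sum, ← Finset.mul_sum, ← (Γ.S b).sum_eq_one]
    congr 2
    ext i j
    simp [Matrix.sum_apply, Finset.mul_sum]
  have hx : ∀ a b y, ∑ x, (Γ.γ * ((Γ.R a).op x ⊗ₖ (Γ.S b).op y)).trace
      = (Γ.γ * (1 ⊗ₖ (Γ.S b).op y)).trace := by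
    intro a b y
    rw [← Matrix.trace_sum, ← Finset.mul_sum, ← (Γ.R a).sum_eq_one]
    congr 2
    ext i j
    simp [Matrix.sum_apply, Finset.sum_mul]
  have hxy : ∀ a b, ∑ x, ∑ y, (Γ.γ * ((Γ.R a).op x ⊗ₖ (Γ.S b).op y)).trace = 1 := by
    intro a b
    rw [Finset.sum_comm]
    simp_rw [hx]
    rw [← Matrix.trace_sum, ← Finset.mul_sum,
      show ∑ y, (1 : Matrix D D ℂ) ⊗ₖ (Γ.S b).op y = 1 from ?_, mul_one, Γ.γ_trace]
    rw [← Matrix.one_kronecker_one, ← (Γ.S b).sum_eq_one]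
    ext i j
    simp [Matrix.sum_apply, Finset.mul_sum]
  refine ⟨⟨fun a b x y => (Γ.γ * ((Γ.R a).op x ⊗ₖ (Γ.S b).op y)).trace.re,
    fun a b x y => (Complex.nonneg_iff.mp (hpos a b x y)).1, fun a b => ?_, fun a b b' x => ?_,
    fun a a' b y => ?_⟩, hre, ?_⟩
  · simp_rw [← Complex.re_sum]
    rw [hxy, Complex.one_re]
  · rw [← Complex.re_sum, ← Complex.re_sum, hy, hy]
  · rw [← Complex.re_sum, ← Complex.re_sum, hx, hx]
  · rintro ⟨p, _, _, _, _⟩ hP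
    congr 1
    funext a b x y
    rw [← hP a b x y, Complex.ofReal_re]

end Strategy

/-! Let `σ a x` be Bob's subnormalized state after Alice alone measures; `∑ x, σ a x` is his reduced
state `τ`, whatever `a` is. Perfect guessing says that `√S σ √S` and `√S σ' √S` have product zero
for distinct outcomes of Alice, hence `σ * S * σ' = 0` for every operator `S` of Bob. Summing over
Bob's outputs gives `σ * σ' = 0`, so for each `a` the support projections `P a x` of the `σ a x` are
orthogonal, add up to the support projection `Q` of `τ`, satisfy `P a x * τ = σ a x`, and commute
with `τ` and with the compressions `Q * S * Q`.

The star algebra generated by the `P a x` may be noncommutative, but it commutes with `τ` and the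
compressions, so `s ↦ tr (s τ Q S Q)` is tracial on it. By Wedderburn the algebra is a product of
full matrix blocks, and on each block a tracial functional is a multiple of the trace. Block `i`
thus contributes (normalized trace of `P a x` in the block) times `tr (z i τ Q S Q)`, with `z i` the
block's unit: a function of Alice's data times a function of Bob's. The block index is the shared
randomness. The main steps are `exists_trace_mul_eq_sum_of_commute` and
`exists_trace_mul_eq_sum_of_mul_mul_eq_zero`. -/

open scoped Kronecker MatrixOrder ComplexOrder

/-! ### Matrix algebra: tracial functionals, semisimplicity, generalized inverses. -/

namespace Matrix

/-- A linear functional on a full matrix algebra which vanishes on commutators is a multiple of the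
trace. -/
theorem linearMap_eq_trace_mul_of_mul_comm {n : Type*} [Fintype n] [DecidableEq n] [Nonempty n]
    (f : Matrix n n ℂ →ₗ[ℂ] ℂ) (hf : ∀ M N, f (M * N) = f (N * M)) (M : Matrix n n ℂ) :
    f M = M.trace / Fintype.card n * f 1 := by
  obtain ⟨k⟩ := ‹Nonempty n›
  have hoff : ∀ i j c, i ≠ j → f (single i j c) = 0 := by
    intro i j c hij
    have h := hf (single i i 1) (single i j c)
    rwa [single_mul_single_same, single_mul_single_of_ne _ _ _ _ hij.symm, one_mul, map_zero] at h
  have hdiag : ∀ i c, f (single i i c) = c * f (single k k 1) := by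
    intro i c
    -- The two products of these matrix units sit at `(i, i)` and `(k, k)`, so all diagonal units
    -- have the same value.
    have h := hf (single i k c) (single k i 1)
    rw [single_mul_single_same, single_mul_single_same, mul_one, one_mul] at h
    rw [h, ← smul_eq_mul, ← map_smul, smul_single, smul_eq_mul, mul_one]
  have hall : ∀ N, f N = N.trace * f (single k k 1) := by
    intro N
    conv_lhs => rw [matrix_eq_sum_single N]
    rw [map_sum, trace, Finset.sum_mul]
    refine Finset.sum_congr rfl fun i _ => ?_
    rw [map_sum, Finset.sum_eq_single i (fun j _ hj => hoff _ _ _ hj.symm) (by simp), hdiag, diag]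
  have hc : (Fintype.card n : ℂ) ≠ 0 := Nat.cast_ne_zero.mpr (Fintype.card_pos_iff.mpr ⟨k⟩).ne'
  rw [hall M, hall 1, trace_one]
  field_simp

/-- The trace of an idempotent complex matrix is a natural number. -/
theorem exists_trace_eq_natCast_of_isIdempotentElem {n : Type*} [Fintype n] [DecidableEq n]
    {M : Matrix n n ℂ} (hM : IsIdempotentElem M) : ∃ k : ℕ, M.trace = k := by
  have h : IsIdempotentElem (toLin' M) := by
    rw [IsIdempotentElem, Module.End.mul_eq_comp, ← toLin'_mul, hM.eq]
  obtain ⟨p, hp⟩ := (LinearMap.isProj_iff_isIdempotentElem _).mpr h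
  exact ⟨Module.finrank ℂ p, by rw [← hp.trace, ← trace_toLin'_eq]⟩

theorem PosSemidef.trace_mul_nonneg {n : Type*} [Fintype n] [DecidableEq n]
    {M N : Matrix n n ℂ} (hM : M.PosSemidef) (hN : N.PosSemidef) : 0 ≤ (M * N).trace := by
  obtain ⟨K, rfl⟩ := CStarAlgebra.nonneg_iff_eq_star_mul_self.mp hM.nonneg
  rw [mul_assoc, trace_mul_comm]
  exact (hN.mul_mul_conjTranspose_same K).trace_nonneg

/-- Since `Mᴴ * M * B = 0` forces `M * B = 0`, a vanishing power of exponent at least two can be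
lowered by one. -/
theorem IsHermitian.eq_zero_of_pow_eq_zero {n : Type*} [Fintype n] [DecidableEq n]
    {M : Matrix n n ℂ} (hM : M.IsHermitian) {k : ℕ} (hk : M ^ k = 0) : M = 0 := by
  induction k with
  | zero => rw [← mul_one M, ← pow_zero M, hk, mul_zero]
  | succ k ih =>
    cases k with
    | zero => simpa using hk
    | succ k =>
      refine ih ?_
      rw [pow_succ', ← conjTranspose_mul_self_mul_eq_zero, hM.eq, mul_assoc, ← pow_succ',
        ← pow_succ', hk]

/-- A star-closed algebra of complex matrices is semisimple. -/
theorem isSemisimpleRing_starSubalgebra {n : Type*} [Fintype n] [DecidableEq n]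
    (S : StarSubalgebra ℂ (Matrix n n ℂ)) : IsSemisimpleRing S := by
  have : FiniteDimensional ℂ S := inferInstanceAs (FiniteDimensional ℂ S.toSubalgebra)
  have : IsArtinianRing S := IsArtinianRing.of_finite ℂ S
  rw [IsArtinianRing.isSemisimpleRing_iff_jacobson, eq_bot_iff]
  intro x hx
  obtain ⟨k, hk⟩ := IsSemiprimaryRing.isNilpotent (R := S)
  -- For `x` in the radical, `star x * x` is nilpotent and Hermitian, hence zero, and then so is
  -- `x`.
  have hy : (star x * x) ^ k = 0 := by
    rw [← Submodule.mem_bot S, ← Ideal.zero_eq_bot, ← hk]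
    exact Ideal.pow_mem_pow (Ideal.mul_mem_left _ _ hx) k
  have h := IsHermitian.eq_zero_of_pow_eq_zero (isHermitian_conjTranspose_mul_self (x : Matrix n n ℂ))
    (congrArg Subtype.val hy)
  exact Subtype.ext (conjTranspose_mul_self_eq_zero.mp h)

/-- Normality makes `(z - zᴴ * z)ᴴ * (z - zᴴ * z)` vanish, so `z = zᴴ * z`, which is self-adjoint.
-/
theorem star_eq_of_isIdempotentElem_of_commute_star {n : Type*} [Fintype n] [DecidableEq n]
    {z : Matrix n n ℂ} (hz : z * z = z) (hc : star z * z = z * star z) : star z = z := by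
  have h : zᴴ * z = z := by
    have h0 : (z - zᴴ * z)ᴴ * (z - zᴴ * z) = 0 := by
      have hz' : zᴴ * zᴴ = zᴴ := by rw [← conjTranspose_mul, hz]
      have hc' : zᴴ * z = z * zᴴ := hc
      have h1 : z * (zᴴ * z) = zᴴ * z := by rw [hc', ← mul_assoc, hz]
      rw [conjTranspose_sub, conjTranspose_mul, conjTranspose_conjTranspose, sub_mul, mul_sub,
        mul_sub, mul_assoc zᴴ z z, hz, mul_assoc zᴴ z (zᴴ * z), h1, ← mul_assoc zᴴ zᴴ, hz']
      simp
    exact (sub_eq_zero.mp (conjTranspose_mul_self_eq_zero.mp h0)).symm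
  have h2 := congrArg conjTranspose h
  rw [conjTranspose_mul, conjTranspose_conjTranspose, h] at h2
  exact h2.symm

/-- A Hermitian matrix has a commuting Hermitian generalized inverse. -/
theorem IsHermitian.exists_generalized_inverse {n : Type*} [Fintype n] [DecidableEq n]
    {M : Matrix n n ℂ} (hM : M.IsHermitian) :
    ∃ N : Matrix n n ℂ, N.IsHermitian ∧ M * N = N * M ∧ M * N * M = M := by
  obtain ⟨φ, v, rfl⟩ : ∃ (φ : Matrix n n ℂ ≃⋆ₐ[ℂ] Matrix n n ℂ) (v : n → ℝ),
      M = φ (diagonal fun i => (v i : ℂ)) := ⟨_, _, hM.spectral_theorem⟩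
  -- Eigenvalues are inverted with `0⁻¹ = 0`, so `v * v⁻¹ * v = v` holds on the kernel too.
  refine ⟨φ (diagonal fun i => ((v i)⁻¹ : ℝ)), ?_, ?_, ?_⟩
  · rw [IsHermitian, ← star_eq_conjTranspose, ← map_star, star_eq_conjTranspose,
      diagonal_conjTranspose]
    congr 2
    ext i
    simp
  · rw [← map_mul, ← map_mul, diagonal_mul_diagonal, diagonal_mul_diagonal]
    simp_rw [mul_comm]
  · rw [← map_mul, ← map_mul, diagonal_mul_diagonal, diagonal_mul_diagonal]
    congr 2
    ext i
    by_cases h0 : v i = 0 <;> simp [h0]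

end Matrix
open Matrix

/-! ### Product decompositions of traces from commutation. -/

/-- Traces of products of idempotents `P a x` with positive semidefinite matrices `T b y` that
commute with them are sums of products, with one summand for each minimal central projection of the
star algebra generated by the idempotents. -/
theorem Matrix.exists_trace_mul_eq_sum_of_commute {A B X Y E : Type*} [Fintype X] [Fintype E]
    [DecidableEq E]
    {P : A → X → Matrix E E ℂ} {σ : Matrix E E ℂ} {T : B → Y → Matrix E E ℂ}
    (hPi : ∀ a x, IsIdempotentElem (P a x))
    (hP1 : ∀ a, ∑ x, P a x = 1) (hσ : σ.PosSemidef) (hT : ∀ b y, (T b y).PosSemidef)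
    (hPσ : ∀ a x, P a x * σ = σ * P a x) (hPT : ∀ a x b y, P a x * T b y = T b y * P a x) :
    ∃ (n : ℕ) (q : Fin n → A → X → ℝ) (z : Fin n → Matrix E E ℂ),
      (∀ i a x, 0 ≤ q i a x) ∧ (∀ i a, ∑ x, q i a x = 1) ∧
      (∀ i b y, 0 ≤ (z i * σ * T b y).trace) ∧
      ∀ a x b y, (P a x * σ * T b y).trace = ∑ i, q i a x * (z i * σ * T b y).trace := by
  classical
  set S : StarSubalgebra ℂ (Matrix E E ℂ) :=
    StarAlgebra.adjoin ℂ (Set.range fun ax : A × X => P ax.1 ax.2)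
  have hPS : ∀ a x, P a x ∈ S := fun a x => StarAlgebra.subset_adjoin ℂ _ ⟨(a, x), rfl⟩
  have hcomm : ∀ N : Matrix E E ℂ, N.IsHermitian → (∀ a x, P a x * N = N * P a x) →
      ∀ M ∈ S, M * N = N * M := by
    intro N hN hPN M hM
    -- `N` is Hermitian, so its centralizer is star-closed and contains the algebra once it contains
    -- the generators.
    have hle : S ≤ StarSubalgebra.centralizer ℂ {N} := by
      refine StarAlgebra.adjoin_le ?_
      rintro _ ⟨⟨a, x⟩, rfl⟩
      rw [SetLike.mem_coe, StarSubalgebra.mem_centralizer_iff]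
      rintro _ rfl
      refine ⟨(hPN a x).symm, ?_⟩
      rw [star_eq_conjTranspose, hN.eq]
      exact (hPN a x).symm
    exact ((StarSubalgebra.mem_centralizer_iff ℂ).mp (hle hM) N rfl).1.symm
  have hSσ := hcomm σ hσ.isHermitian hPσ
  have hST : ∀ b y, ∀ M ∈ S, M * T b y = T b y * M :=
    fun b y => hcomm _ (hT b y).isHermitian fun a x => hPT a x b y
  have : FiniteDimensional ℂ S := inferInstanceAs (FiniteDimensional ℂ S.toSubalgebra)
  have := isSemisimpleRing_starSubalgebra S
  obtain ⟨n, d, hd, ⟨e⟩⟩ := IsSemisimpleRing.exists_algEquiv_pi_matrix_of_isAlgClosed ℂ S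
  -- The units of the Wedderburn blocks; being central idempotents, they are normal, hence
  -- Hermitian.
  set z : Fin n → S := fun i => e.symm (Pi.single i 1)
  have hzz : ∀ i, z i * z i = z i := by
    intro i
    rw [← map_mul, ← Pi.single_mul, one_mul]
  have hzc : ∀ i s, z i * s = s * z i := by
    intro i s
    apply e.injective
    rw [map_mul, map_mul, e.apply_symm_apply, ← Pi.single_mul_left, ← Pi.single_mul_right, one_mul, mul_one]
  have hzh : ∀ i, (z i : Matrix E E ℂ)ᴴ = z i := fun i =>
    star_eq_of_isIdempotentElem_of_commute_star (congrArg Subtype.val (hzz i))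
      (congrArg Subtype.val (hzc i (star (z i)))).symm
  have hz0 : ∀ i b y, 0 ≤ ((z i : Matrix E E ℂ) * σ * T b y).trace := by
    intro i b y
    have h : (z i : Matrix E E ℂ) * σ = z i * σ * (z i : Matrix E E ℂ)ᴴ := by
      rw [hzh, mul_assoc, ← hSσ _ (z i).2, ← mul_assoc]
      exact congrArg (· * σ) (congrArg Subtype.val (hzz i)).symm
    rw [h]
    exact (hσ.mul_mul_conjTranspose_same _).trace_mul_nonneg (hT b y)
  set p : A → X → S := fun a x => ⟨P a x, hPS a x⟩
  have hidem : ∀ a x i, IsIdempotentElem (e (p a x) i) := by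
    intro a x i
    have hp : p a x * p a x = p a x := Subtype.ext (hPi a x).eq
    rw [IsIdempotentElem, ← Pi.mul_apply, ← map_mul, hp]
  choose k hk using fun a x i => exists_trace_eq_natCast_of_isIdempotentElem (hidem a x i)
  -- Alice's distribution in block `i` is the rank of the block of `P a x` over the block size.
  refine ⟨n, fun i a x => k a x i / d i, fun i => z i, fun i a x => by positivity, ?_, hz0, ?_⟩
  · intro i a
    have hd0 : (d i : ℂ) ≠ 0 := Nat.cast_ne_zero.mpr (hd i).ne
    have hp : ∑ x, p a x = 1 := Subtype.ext (by simpa [p] using hP1 a)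
    have h : ∑ x, (k a x i : ℂ) = d i := by
      simp_rw [← hk]
      rw [← trace_sum, ← Finset.sum_apply, ← map_sum, hp, map_one, Pi.one_apply, trace_one,
        Fintype.card_fin]
    rw [← Finset.sum_div, div_eq_one_iff_eq (by exact_mod_cast hd0)]
    exact_mod_cast h
  · intro a x b y
    let f : S →ₗ[ℂ] ℂ :=
      { toFun := fun s => ((s : Matrix E E ℂ) * σ * T b y).trace
        map_add' := fun s t => by simp [add_mul]
        map_smul' := fun c s => by simp }
    have hf : ∀ s t, f (s * t) = f (t * s) := by
      intro s t
      change ((s * t : Matrix E E ℂ) * σ * T b y).trace = ((t * s : Matrix E E ℂ) * σ * T b y).trace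
      rw [mul_assoc (s : Matrix E E ℂ), hSσ _ t.2, mul_assoc (s : Matrix E E ℂ), mul_assoc σ,
        hST b y _ t.2, ← mul_assoc, ← mul_assoc, trace_mul_comm, mul_assoc (t : Matrix E E ℂ),
        ← mul_assoc, ← mul_assoc]
    let g : ∀ i, Matrix (Fin (d i)) (Fin (d i)) ℂ →ₗ[ℂ] ℂ := fun i =>
      f ∘ₗ e.symm.toLinearMap ∘ₗ LinearMap.single ℂ (fun i => Matrix (Fin (d i)) (Fin (d i)) ℂ) i
    have hg : ∀ i (M N : Matrix (Fin (d i)) (Fin (d i)) ℂ), g i (M * N) = g i (N * M) := by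
      intro i M N
      change f (e.symm (Pi.single i (M * N))) = f (e.symm (Pi.single i (N * M)))
      rw [Pi.single_mul, Pi.single_mul, map_mul e.symm, map_mul e.symm, hf]
    have hsum : f (p a x) = ∑ i, g i (e (p a x) i) := by
      conv_lhs => rw [← e.symm_apply_apply (p a x), ← Finset.univ_sum_single (e (p a x))]
      rw [map_sum, map_sum]
      rfl
    refine hsum.trans (Finset.sum_congr rfl fun i _ => ?_)
    have := Fin.pos_iff_nonempty.mp (hd i).pos
    -- Here `g i 1` is `f (z i)`, which is Bob's factor.
    rw [linearMap_eq_trace_mul_of_mul_comm (g i) (hg i), hk, Fintype.card_fin]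
    push_cast
    rfl

/-- Ensembles `σ a` of a common state `τ` which remain perfectly distinguishable after each of the
measurements `S b` give rise to sums of products: the support projections of the ensemble members
commute with `τ` and with the compressions of the `S b y` to the support of `τ`. -/
theorem Matrix.exists_trace_mul_eq_sum_of_mul_mul_eq_zero {A B X Y E : Type*} [Fintype X]
    [Nonempty X] [Nonempty A] [Nonempty B] [Fintype Y] [Fintype E] [DecidableEq E]
    {σ : A → X → Matrix E E ℂ} {τ : Matrix E E ℂ} {S : B → Y → Matrix E E ℂ}
    (hσ : ∀ a x, (σ a x).PosSemidef) (hτ : ∀ a, ∑ x, σ a x = τ)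
    (hS : ∀ b y, (S b y).PosSemidef) (hS1 : ∀ b, ∑ y, S b y = 1)
    (h0 : ∀ a x x' b y, x ≠ x' → σ a x * S b y * σ a x' = 0) :
    ∃ (n : ℕ) (q : Fin n → A → X → ℝ) (w : Fin n → ℝ) (r : Fin n → B → Y → ℝ),
      (∀ i a x, 0 ≤ q i a x) ∧ (∀ i a, ∑ x, q i a x = 1) ∧
      (∀ i b y, 0 ≤ r i b y) ∧ (∀ i b, ∑ y, r i b y = w i) ∧
      ∀ a b x y, (σ a x * S b y).trace = ∑ i, (q i a x * r i b y : ℝ) := by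
  classical
  obtain ⟨a₀⟩ := ‹Nonempty A›
  obtain ⟨b₀⟩ := ‹Nonempty B›
  obtain ⟨x₀⟩ := ‹Nonempty X›
  choose N hNh hNc hN using fun a x => (hσ a x).isHermitian.exists_generalized_inverse
  -- A Hermitian matrix times its commuting generalized inverse is its support projection.
  set P : A → X → Matrix E E ℂ := fun a x => σ a x * N a x
  have hPh : ∀ a x, (P a x)ᴴ = P a x := fun a x => by
    rw [conjTranspose_mul, (hNh a x).eq, (hσ a x).isHermitian.eq, ← hNc]
  have hPN : ∀ a x, P a x = N a x * σ a x := hNc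
  have hσσ : ∀ a x x', x ≠ x' → σ a x * σ a x' = 0 := fun a x x' h => by
    rw [← mul_one (σ a x), ← hS1 b₀, Finset.mul_sum, Finset.sum_mul]
    exact Finset.sum_eq_zero fun y _ => h0 a x x' b₀ y h
  have hPP : ∀ a x x', x ≠ x' → P a x * P a x' = 0 := fun a x x' h => by
    rw [hPN a x, mul_assoc, ← mul_assoc (σ a x), hσσ a x x' h, zero_mul, mul_zero]
  have hPi : ∀ a x, P a x * P a x = P a x := fun a x => by
    change σ a x * N a x * (σ a x * N a x) = σ a x * N a x
    rw [← mul_assoc, hN]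
  have hPτ : ∀ a x, P a x * τ = σ a x := fun a x => by
    rw [← hτ a, Finset.mul_sum, Finset.sum_eq_single x, hN]
    · intro x' _ h
      rw [hPN, mul_assoc, hσσ a x x' h.symm, mul_zero]
    · simp
  have hτh : τᴴ = τ := by
    rw [← hτ a₀, conjTranspose_sum]
    exact Finset.sum_congr rfl fun x _ => (hσ a₀ x).isHermitian.eq
  have hτP : ∀ a x, τ * P a x = σ a x := fun a x => by
    have h := congrArg conjTranspose (hPτ a x)
    rwa [conjTranspose_mul, hPh, hτh, (hσ a x).isHermitian.eq] at h
  have hτN : ∀ a x, τ * (N a x * P a x) = P a x := fun a x => by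
    have h : N a x * P a x = P a x * N a x := by rw [hPN a x, mul_assoc, hNc]
    rw [h, ← mul_assoc, hτP]
  -- Each `P a' x` has `τ` as a left factor by `hτN`, and `∑ x, P a x` fixes `τ`. Taking adjoints
  -- then shows that the sum does not depend on `a`.
  have hall : ∀ a a', (∑ x, P a x) * ∑ x, P a' x = ∑ x, P a' x := fun a a' => by
    rw [Finset.mul_sum]
    refine Finset.sum_congr rfl fun x _ => ?_
    rw [← hτN a' x, ← mul_assoc, Finset.sum_mul]
    simp_rw [hPτ, hτ]
  set Q : Matrix E E ℂ := ∑ x, P a₀ x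
  have hsumh : ∀ a, (∑ x, P a x)ᴴ = ∑ x, P a x := fun a => by
    rw [conjTranspose_sum]
    exact Finset.sum_congr rfl fun x _ => hPh a x
  have hQh : Qᴴ = Q := hsumh a₀
  have hQ : ∀ a, ∑ x, P a x = Q := fun a => by
    have h := congrArg conjTranspose (hall a a₀)
    rw [conjTranspose_mul, hsumh, hsumh, hall] at h
    exact h
  have hPQ : ∀ a x, P a x * Q = P a x := fun a x => by
    rw [← hQ a, Finset.mul_sum, Finset.sum_eq_single x, hPi]
    · exact fun x' _ h => hPP a x x' h.symm
    · simp
  have hQP : ∀ a x, Q * P a x = P a x := fun a x => by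
    have h := congrArg conjTranspose (hPQ a x)
    rwa [conjTranspose_mul, hPh, hQh] at h
  have hQτ : Q * τ = τ := by
    rw [Finset.sum_mul]
    simp_rw [hPτ]
    exact hτ a₀
  have hτQ : τ * Q = τ := by
    have h := congrArg conjTranspose hQτ
    rwa [conjTranspose_mul, hτh, hQh] at h
  have hQQ : Q * Q = Q := hall a₀ a₀
  set T : B → Y → Matrix E E ℂ := fun b y => Q * S b y * Q
  have hPSP : ∀ a x x' b y, x ≠ x' → P a x * S b y * P a x' = 0 := fun a x x' b y h => by
    rw [hPN a x, show N a x * σ a x * S b y * P a x' = N a x * (σ a x * S b y * σ a x') * N a x' by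
      simp only [P, mul_assoc], h0 a x x' b y h, mul_zero, zero_mul]
  have hPT : ∀ a x b y, P a x * T b y = T b y * P a x := by
    intro a x b y
    -- Expanding `Q` as `∑ x', P a x'`, only `x' = x` survives by `hPSP`.
    have h1 : P a x * T b y = P a x * S b y * P a x := by
      rw [← mul_assoc, ← mul_assoc, hPQ, ← hQ a, Finset.mul_sum, Finset.sum_eq_single x]
      · exact fun x' _ h => hPSP a x x' b y h.symm
      · simp
    have h2 : T b y * P a x = P a x * S b y * P a x := by
      rw [mul_assoc, hQP, ← hQ a, Finset.sum_mul, Finset.sum_mul, Finset.sum_eq_single x]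
      · exact fun x' _ h => hPSP a x' x b y h
      · simp
    rw [h1, h2]
  have hQT : ∀ b y, Q * T b y = T b y := fun b y => by
    rw [← mul_assoc, ← mul_assoc, hQQ]
  have hTQ : ∀ b y, T b y * Q = T b y := fun b y => by
    rw [mul_assoc, hQQ]
  -- Assigning `1 - Q` to one outcome completes the projections to a resolution of the identity; as
  -- `1 - Q` annihilates `τ` and every `T b y`, no trace changes.
  set P' : A → X → Matrix E E ℂ := fun a x => P a x + if x = x₀ then 1 - Q else 0
  have hP'i : ∀ a x, IsIdempotentElem (P' a x) := fun a x => by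
    simp only [P', IsIdempotentElem]
    split_ifs
    · simp only [add_mul, mul_add, mul_sub, sub_mul, hPi, hPQ, hQP, hQQ, mul_one, one_mul]
      abel
    · simp [hPi]
  have hP'1 : ∀ a, ∑ x, P' a x = 1 := fun a => by
    simp [P', Finset.sum_add_distrib, hQ]
  have hτp : τ.PosSemidef := by
    rw [← hτ a₀]
    exact posSemidef_sum _ fun x _ => hσ a₀ x
  have hTp : ∀ b y, (T b y).PosSemidef := fun b y => by
    have h := (hS b y).mul_mul_conjTranspose_same Q
    rwa [hQh] at h
  have hP'τ : ∀ a x, P' a x * τ = τ * P' a x := fun a x => by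
    simp only [P', add_mul, mul_add, hPτ, hτP]
    split_ifs <;> simp [sub_mul, mul_sub, hQτ, hτQ]
  have hP'T : ∀ a x b y, P' a x * T b y = T b y * P' a x := fun a x b y => by
    simp only [P', add_mul, mul_add, hPT]
    split_ifs <;> simp [sub_mul, mul_sub, hQT, hTQ]
  obtain ⟨n, q, z, hq, hq1, hz, hsum⟩ :=
    exists_trace_mul_eq_sum_of_commute hP'i hP'1 hτp hTp hP'τ hP'T
  refine ⟨n, q, fun i => (z i * τ).trace.re, fun i b y => (z i * τ * T b y).trace.re, hq, hq1,
    fun i b y => (Complex.nonneg_iff.mp (hz i b y)).1, fun i b => ?_, fun a b x y => ?_⟩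
  · rw [← Complex.re_sum, ← trace_sum, ← Finset.mul_sum, ← Finset.sum_mul, ← Finset.mul_sum, hS1,
      mul_one, hQQ, mul_assoc, hτQ]
  · have hre : ∀ i, ((z i * τ * T b y).trace.re : ℂ) = (z i * τ * T b y).trace := fun i =>
      (Complex.eq_re_of_ofReal_le (hz i b y)).symm
    push_cast
    simp_rw [hre]
    rw [← hsum]
    have h1 : P' a x * τ = σ a x := by
      simp only [P', add_mul, hPτ]
      split_ifs <;> simp [sub_mul, hQτ]
    have h2 : σ a x * Q = σ a x := by
      rw [← hτP a x, mul_assoc, hPQ]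
    have h3 : Q * σ a x = σ a x := by
      rw [← hPτ a x, ← mul_assoc, hQP]
    rw [h1, ← mul_assoc, ← mul_assoc, h2, trace_mul_comm _ Q, ← mul_assoc, h3]

/-! ### Partial trace over the first factor. -/

section PartialTrace

variable {D E : Type*} [Fintype D]

theorem trace_partialTraceLeft_mul [Fintype E] [DecidableEq D] (M : Matrix (D × E) (D × E) ℂ)
    (K : Matrix E E ℂ) :
    (partialTraceLeft M * K).trace = (M * ((1 : Matrix D D ℂ) ⊗ₖ K)).trace := by
  simp only [partialTraceLeft, trace, diag, mul_apply, of_apply, kroneckerMap_apply, one_apply,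
    Fintype.sum_prod_type, Finset.sum_mul, ite_mul, one_mul, zero_mul, mul_ite, mul_zero]
  simp only [Finset.sum_comm (s := (Finset.univ : Finset D)) (t := (Finset.univ : Finset E))]
  simp

theorem partialTraceLeft_one_kronecker_mul_mul [Fintype E] [DecidableEq D]
    (M : Matrix (D × E) (D × E) ℂ) (K L : Matrix E E ℂ) :
    partialTraceLeft (((1 : Matrix D D ℂ) ⊗ₖ K) * M * ((1 : Matrix D D ℂ) ⊗ₖ L)) =
      K * partialTraceLeft M * L := by
  ext e e'
  simp only [partialTraceLeft, mul_apply, of_apply, kroneckerMap_apply, one_apply,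
    Fintype.sum_prod_type, Finset.sum_mul, Finset.mul_sum, ite_mul, one_mul, zero_mul, mul_ite,
    mul_zero]
  simp [Finset.sum_comm (s := (Finset.univ : Finset D)) (t := (Finset.univ : Finset E))]

/-- Cyclicity of the trace persists for operators acting only on the factor traced out. -/
theorem partialTraceLeft_kronecker_one_mul [Fintype E] [DecidableEq E]
    (M : Matrix (D × E) (D × E) ℂ) (K : Matrix D D ℂ) :
    partialTraceLeft ((K ⊗ₖ (1 : Matrix E E ℂ)) * M) =
      partialTraceLeft (M * (K ⊗ₖ (1 : Matrix E E ℂ))) := by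
  ext e e'
  simp only [partialTraceLeft, mul_apply, of_apply, kroneckerMap_apply, one_apply,
    Fintype.sum_prod_type, ite_mul, zero_mul, mul_ite, mul_one, mul_zero,
    Finset.sum_ite_eq, Finset.sum_ite_eq', Finset.mem_univ, if_true]
  rw [Finset.sum_comm]
  simp only [mul_comm]

theorem Matrix.PosSemidef.partialTraceLeft {M : Matrix (D × E) (D × E) ℂ} (hM : M.PosSemidef) :
    (_root_.partialTraceLeft M).PosSemidef := by
  have h : _root_.partialTraceLeft M = ∑ d, M.submatrix (fun e => (d, e)) fun e => (d, e) := by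
    ext e e'
    simp [_root_.partialTraceLeft, Matrix.sum_apply]
  rw [h]
  exact posSemidef_sum _ fun d _ => hM.submatrix _

theorem partialTraceLeft_sum {X : Type*} [Fintype X] (M : X → Matrix (D × E) (D × E) ℂ) :
    partialTraceLeft (∑ x, M x) = ∑ x, partialTraceLeft (M x) := by
  ext e e'
  simp only [partialTraceLeft, of_apply, Matrix.sum_apply]
  exact Finset.sum_comm

end PartialTrace

/-! ### Orthogonal supports and square roots. -/

theorem mul_eq_zero_of_isOrtho_opSupport {E : Type*} [Fintype E] [DecidableEq E]
    {M N : Matrix E E ℂ} (hM : M.IsHermitian) (hN : N.IsHermitian)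
    (h : (opSupport M).IsOrtho (opSupport N)) : M * N = 0 := by
  have hrange : ∀ {K : Matrix E E ℂ}, K.IsHermitian → ∀ v, toEuclideanLin K v ∈ opSupport K := by
    intro K hK v
    rw [opSupport, Submodule.mem_orthogonal]
    intro u hu
    rw [← (isSymmetric_toEuclideanLin_iff.mpr hK) u v, LinearMap.mem_ker.mp hu, inner_zero_left]
  apply toEuclideanLin.injective
  ext1 v
  have hv := (isSymmetric_toEuclideanLin_iff.mpr hM)
  have hmul : toEuclideanLin (M * N) v = toEuclideanLin M (toEuclideanLin N v) := by
    simp [toLpLin_apply]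
  rw [hmul, map_zero, LinearMap.zero_apply]
  refine ext_inner_left ℂ fun u => ?_
  rw [← hv, inner_zero_right]
  exact h.inner_eq (hrange hM u) (hrange hN v)

theorem sqrt_kronecker {D E : Type*} [Fintype D] [DecidableEq D] [Fintype E] [DecidableEq E]
    {M : Matrix D D ℂ} {N : Matrix E E ℂ} (hM : M.PosSemidef) (hN : N.PosSemidef) :
    CFC.sqrt (M ⊗ₖ N) = CFC.sqrt M ⊗ₖ CFC.sqrt N := by
  refine CFC.sqrt_unique ?_ ?_
  · rw [← mul_kronecker_mul, CFC.sqrt_mul_sqrt_self _ hM.nonneg, CFC.sqrt_mul_sqrt_self _ hN.nonneg]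
  · exact ((nonneg_iff_posSemidef.mp (CFC.sqrt_nonneg M)).kronecker
      (nonneg_iff_posSemidef.mp (CFC.sqrt_nonneg N))).nonneg

/-- The hypothesis reads `(M * K)ᴴ * (M * K) * ((N * K)ᴴ * (N * K)) = 0`; cancelling the outer
factors leaves `M * K * (K * N) = 0`. -/
theorem mul_mul_eq_zero_of_isHermitian {E : Type*} [Fintype E] {M N K : Matrix E E ℂ}
    (hM : M.IsHermitian) (hN : N.IsHermitian) (hK : K.IsHermitian)
    (h : K * (M * M) * K * (K * (N * N) * K) = 0) : M * M * (K * K) * (N * N) = 0 := by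
  have hfac : ∀ L : Matrix E E ℂ, L.IsHermitian → (L * K)ᴴ * (L * K) = K * (L * L) * K :=
    fun L hL => by rw [conjTranspose_mul, hL.eq, hK.eq]; simp only [Matrix.mul_assoc]
  rw [← hfac M hM, ← hfac N hN, conjTranspose_mul_self_mul_eq_zero,
    mul_conjTranspose_mul_self_eq_zero, conjTranspose_mul, hN.eq, hK.eq] at h
  calc M * M * (K * K) * (N * N) = M * (M * K * (K * N)) * N := by simp only [Matrix.mul_assoc]
    _ = 0 := by rw [h, Matrix.mul_zero, Matrix.zero_mul]

/-- For positive semidefinite `M`, `N`, `K`, if `√K M √K` and `√K N √K` have product zero, then so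
do `M`, `K`, `N`. -/
theorem mul_mul_eq_zero_of_sqrt_conj_mul_eq_zero {E : Type*} [Fintype E] [DecidableEq E]
    {M N K : Matrix E E ℂ} (hM : M.PosSemidef) (hN : N.PosSemidef) (hK : K.PosSemidef)
    (h : (CFC.sqrt K * M * CFC.sqrt K) * (CFC.sqrt K * N * CFC.sqrt K) = 0) : M * K * N = 0 := by
  have hsq : ∀ L : Matrix E E ℂ, L.PosSemidef → ∃ S, S = CFC.sqrt L ∧ S.IsHermitian ∧ S * S = L :=
    fun L hL => ⟨_, rfl, (nonneg_iff_posSemidef.mp (CFC.sqrt_nonneg L)).isHermitian,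
      CFC.sqrt_mul_sqrt_self L hL.nonneg⟩
  obtain ⟨M', -, hM', rfl⟩ := hsq M hM
  obtain ⟨N', -, hN', rfl⟩ := hsq N hN
  obtain ⟨K', hK', hKh, hKK⟩ := hsq K hK
  rw [← hK'] at h
  rw [← hKK]
  exact mul_mul_eq_zero_of_isHermitian hM' hN' hKh h

/-! ### Normalizing a sum of products to a convex combination. -/

/-- A finite sum of products of nonnegative functions of each player's data, with total weights
independent of the inputs, is a classical correlation. -/
theorem Correlation.isClassical_of_eq_sum {A B X Y : Type*} [Fintype X] [Fintype Y] [Nonempty A]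
    [Nonempty B] (P : Correlation A B X Y) {ι : Type*} [Fintype ι] {q : ι → A → X → ℝ} {w : ι → ℝ}
    {r : ι → B → Y → ℝ} (hq : ∀ i a x, 0 ≤ q i a x) (hq1 : ∀ i a, ∑ x, q i a x = 1)
    (hr : ∀ i b y, 0 ≤ r i b y) (hr1 : ∀ i b, ∑ y, r i b y = w i)
    (hP : ∀ a b x y, P.p a b x y = ∑ i, q i a x * r i b y) : P.IsClassical := by
  classical
  obtain ⟨a₀⟩ := ‹Nonempty A›
  obtain ⟨b₀⟩ := ‹Nonempty B›
  have hw : ∀ i, 0 ≤ w i := fun i => hr1 i b₀ ▸ Finset.sum_nonneg fun y _ => hr i b₀ y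
  have hw1 : ∑ i, w i = 1 := by
    rw [← P.sum_eq_one a₀ b₀]
    simp_rw [hP]
    rw [Finset.sum_comm_cycle]
    refine Finset.sum_congr rfl fun i _ => ?_
    rw [← Finset.sum_mul_sum, hq1, hr1, one_mul]
  obtain ⟨y₀⟩ : Nonempty Y := by
    by_contra hY
    rw [not_nonempty_iff] at hY
    simpa using P.sum_eq_one a₀ b₀
  -- A term of weight zero has `r i = 0`, so any distribution serves there; a point mass at `y₀` is
  -- chosen.
  set r' : ι → B → Y → ℝ := fun i b y => if w i = 0 then (if y = y₀ then 1 else 0) else r i b y / w i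
  have hwr : ∀ i b y, w i * r' i b y = r i b y := by
    intro i b y
    by_cases h : w i = 0
    · have h0 := (Finset.sum_eq_zero_iff_of_nonneg fun y _ => hr i b y).mp ((hr1 i b).trans h) y
        (Finset.mem_univ y)
      rw [h, zero_mul, h0]
    · simp only [r', if_neg h]
      field_simp
  have hmem : ∑ i, w i • (fun a b x y => q i a x * r' i b y : A → B → X → Y → ℝ) ∈
      convexHull ℝ (productCorrelations A B X Y) := by
    refine (convex_convexHull ℝ _).sum_mem (fun i _ => hw i) hw1 fun i _ =>
      subset_convexHull ℝ _ ⟨q i, r' i, hq i, hq1 i, fun b y => ?_, fun b => ?_, fun _ _ _ _ => rfl⟩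
    · simp only [r']
      split_ifs <;> first | positivity | exact div_nonneg (hr i b y) (hw i)
    · by_cases h : w i = 0
      · simp [r', h]
      · simp only [r', if_neg h]
        rw [← Finset.sum_div, hr1, div_self h]
  rw [Correlation.IsClassical]
  convert hmem using 1
  funext a b x y
  simp only [hP, Finset.sum_apply, Pi.smul_apply, smul_eq_mul]
  refine Finset.sum_congr rfl fun i _ => ?_
  rw [← hwr]
  ring

/-! ### Bob's states in a strategy, and the corollary. -/

namespace Strategy

variable {A B X Y D E : Type*} [Fintype X] [Fintype Y]
  [Fintype D] [DecidableEq D] [Fintype E] [DecidableEq E]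

/-- The subnormalized state of the second player after the first player has measured. -/
noncomputable def intermediateState (Γ : Strategy A B X Y D E) (a : A) (x : X) : Matrix E E ℂ :=
  partialTraceLeft (Γ.γ * ((Γ.R a).op x ⊗ₖ 1))

theorem partialTraceLeft_sqrt_mul_mul_sqrt (Γ : Strategy A B X Y D E) (a : A) (x : X) :
    partialTraceLeft ((CFC.sqrt ((Γ.R a).op x) ⊗ₖ (1 : Matrix E E ℂ)) * Γ.γ *
      (CFC.sqrt ((Γ.R a).op x) ⊗ₖ (1 : Matrix E E ℂ))) = Γ.intermediateState a x := by
  rw [mul_assoc, partialTraceLeft_kronecker_one_mul, mul_assoc, ← mul_kronecker_mul,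
    CFC.sqrt_mul_sqrt_self _ ((Γ.R a).posSemidef x).nonneg, mul_one, intermediateState]

theorem intermediateState_posSemidef (Γ : Strategy A B X Y D E) (a : A) (x : X) :
    (Γ.intermediateState a x).PosSemidef := by
  have hs := (nonneg_iff_posSemidef.mp (CFC.sqrt_nonneg ((Γ.R a).op x))).isHermitian.eq
  have h := Γ.γ_posSemidef.mul_mul_conjTranspose_same
    (CFC.sqrt ((Γ.R a).op x) ⊗ₖ (1 : Matrix E E ℂ))
  rw [conjTranspose_kronecker, hs, conjTranspose_one] at h
  rw [← partialTraceLeft_sqrt_mul_mul_sqrt]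
  exact h.partialTraceLeft

theorem sum_intermediateState (Γ : Strategy A B X Y D E) (a : A) :
    ∑ x, Γ.intermediateState a x = partialTraceLeft Γ.γ := by
  have h : ∑ x, (Γ.R a).op x ⊗ₖ (1 : Matrix E E ℂ) = 1 := by
    rw [← one_kronecker_one, ← (Γ.R a).sum_eq_one]
    ext i j
    simp [Matrix.sum_apply, Finset.sum_mul]
  simp_rw [intermediateState]
  rw [← partialTraceLeft_sum, ← Finset.mul_sum, h, mul_one]

theorem trace_intermediateState_mul (Γ : Strategy A B X Y D E) (a : A) (b : B) (x : X) (y : Y) :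
    (Γ.intermediateState a x * (Γ.S b).op y).trace =
      (Γ.γ * ((Γ.R a).op x ⊗ₖ (Γ.S b).op y)).trace := by
  rw [intermediateState, trace_partialTraceLeft_mul, mul_assoc, ← mul_kronecker_mul, mul_one,
    one_mul]

/-- Bob's square root factors out of the partial trace, while Alice's two square roots recombine
inside it by cyclicity. -/
theorem secondPlayerState_eq (Γ : Strategy A B X Y D E) (a : A) (b : B) (x : X) (y : Y) :
    Γ.secondPlayerState a b x y =
      CFC.sqrt ((Γ.S b).op y) * Γ.intermediateState a x * CFC.sqrt ((Γ.S b).op y) := by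
  set R := CFC.sqrt ((Γ.R a).op x) with hR
  set S := CFC.sqrt ((Γ.S b).op y)
  have h1 : R ⊗ₖ S = ((1 : Matrix D D ℂ) ⊗ₖ S) * (R ⊗ₖ (1 : Matrix E E ℂ)) := by
    rw [← mul_kronecker_mul, one_mul, mul_one]
  have h2 : R ⊗ₖ S = (R ⊗ₖ (1 : Matrix E E ℂ)) * ((1 : Matrix D D ℂ) ⊗ₖ S) := by
    rw [← mul_kronecker_mul, one_mul, mul_one]
  rw [secondPlayerState, sqrt_kronecker ((Γ.R a).posSemidef x) ((Γ.S b).posSemidef y)]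
  calc _ = partialTraceLeft (((1 : Matrix D D ℂ) ⊗ₖ S) *
        ((R ⊗ₖ (1 : Matrix E E ℂ)) * Γ.γ * (R ⊗ₖ (1 : Matrix E E ℂ))) *
        ((1 : Matrix D D ℂ) ⊗ₖ S)) := by
        change partialTraceLeft (R ⊗ₖ S * Γ.γ * (R ⊗ₖ S)) = _
        nth_rewrite 1 [h1]
        rw [h2]
        simp only [mul_assoc]
    _ = _ := by
        rw [partialTraceLeft_one_kronecker_mul_mul, hR, partialTraceLeft_sqrt_mul_mul_sqrt]

theorem AllowsPerfectGuessing.mul_mul_eq_zero {Γ : Strategy A B X Y D E}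
    (h : Γ.AllowsPerfectGuessing) (a : A) (x x' : X) (b : B) (y : Y) (hx : x ≠ x') :
    Γ.intermediateState a x * (Γ.S b).op y * Γ.intermediateState a x' = 0 := by
  have hherm : ∀ x, (Γ.secondPlayerState a b x y).IsHermitian := fun x => by
    have hs := (nonneg_iff_posSemidef.mp (CFC.sqrt_nonneg ((Γ.S b).op y))).isHermitian.eq
    have h := (Γ.intermediateState_posSemidef a x).mul_mul_conjTranspose_same
      (CFC.sqrt ((Γ.S b).op y))
    rw [hs, ← secondPlayerState_eq] at h
    exact h.isHermitian
  have h0 := mul_eq_zero_of_isOrtho_opSupport (hherm x) (hherm x') (h a b y x x' hx)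
  rw [secondPlayerState_eq, secondPlayerState_eq] at h0
  exact mul_mul_eq_zero_of_sqrt_conj_mul_eq_zero (Γ.intermediateState_posSemidef a x)
    (Γ.intermediateState_posSemidef a x') ((Γ.S b).posSemidef y) h0

theorem AllowsPerfectGuessing.isClassical [Nonempty A] [Nonempty B] {Γ : Strategy A B X Y D E}
    (h : Γ.AllowsPerfectGuessing) {P : Correlation A B X Y} (hP : Γ.Achieves P) :
    P.IsClassical := by
  obtain ⟨a₀⟩ := ‹Nonempty A›
  obtain ⟨b₀⟩ := ‹Nonempty B›
  have : Nonempty X := by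
    by_contra hX
    rw [not_nonempty_iff] at hX
    simpa using P.sum_eq_one a₀ b₀
  obtain ⟨n, q, w, r, hq, hq1, hr, hr1, hsum⟩ :=
    exists_trace_mul_eq_sum_of_mul_mul_eq_zero Γ.intermediateState_posSemidef
      Γ.sum_intermediateState (fun b => (Γ.S b).posSemidef) (fun b => (Γ.S b).sum_eq_one)
      h.mul_mul_eq_zero
  refine P.isClassical_of_eq_sum hq hq1 hr hr1 fun a b x y => ?_
  have hp := hP a b x y
  rw [← trace_intermediateState_mul, hsum] at hp
  exact_mod_cast hp

end Strategy

theorem corollary3 {A B X Y D E : Type*} [Fintype A] [Fintype B] [Fintype X] [Fintype Y]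
    [Fintype D] [DecidableEq D] [Fintype E] [DecidableEq E]
    (G : Game A B X Y) (hG : G.HasCompleteSupport)
    (Γ : Strategy A B X Y D E) (P : Correlation A B X Y) (hP : Γ.Achieves P) :
    (Γ.AllowsPerfectGuessing → P.IsClassical) ∧
      (G.IsSuperclassical P → ¬ Γ.AllowsPerfectGuessing) := by
  have hA : Nonempty A := by
    by_contra h
    rw [not_nonempty_iff] at h
    simpa using G.q_sum
  have hB : Nonempty B := by
    by_contra h
    rw [not_nonempty_iff] at h
    simpa using G.q_sum
  exact ⟨fun h => h.isClassical hP, fun hs h => lt_irrefl _ (hs P (h.isClassical hP))⟩
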